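/- Let $\mathcal K^2(\mathbb R^2_1)$ be the space of Killing two-tensors of the Minkowski plane with coordinates $(t,x)$. Its elements are $$K=\begin{pmatrix} a_0+2a_3x+a_5x^2 & a_1+a_3t+a_4x+a_5tx\\ a_1+a_3t+a_4x+a_5tx & a_2+2a_4t+a_5t^2\end{pmatrix},$$ with parameter space $\Sigma=\mathbb R^6\ni(a_0,\dots,a_5)$. The connected isometry group $I(\mathbb R^2_1)$, consisting of the maps $(t,x)\mapsto(t\cosh\phi+x\sinh\phi+a,\;t\sinh\phi+x\cosh\phi+b)$, acts on $\Sigma$ by transforming $K$ as a $(2,0)$-tensor; write $g\cdot p$ for this action. Its infinitesimal generators on $\Sigma$ are $$V_1=a_3\partial_{a_1}+2a_4\partial_{a_2}+a_5\partial_{a_4},\qquad V_2=2a_3\partial_{a_0}+a_4\partial_{a_1}+a_5\partial_{a_3},$$ $$V_3=-2a_1\partial_{a_0}-(a_0+a_2)\partial_{a_1}-2a_1\partial_{a_2}-a_4\partial_{a_3}-a_3\partial_{a_4}.$$ Let $R\subset\Sigma$ be the set of points at which $V_1,V_2,V_3$ are linearly independent. For an open set $U\subset\Sigma$, an (analytic)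 $I(\mathbb R^2_1)$-invariant on $U$ is a real-analytic function $\mathcal I:U\to\mathbb R$ such that $\mathcal I(g\cdot p)=\mathcal I(p)$ whenever $g\in I(\mathbb R^2_1)$ and $p,\,g\cdot p\in U$. Put $$\Delta_1=a_5,\qquad \Delta_2=(a_0-a_2)a_5-a_3^2+a_4^2,\qquad \Delta_3=\bigl(a_3^2+a_4^2-a_5(a_0+a_2)\bigr)^2-4(a_5a_1-a_3a_4)^2 .$$ **Theorem.** (i) $\Delta_1,\Delta_2,\Delta_3$ are $I(\mathbb R^2_1)$-invariants on $\Sigma$. (ii) At a point of $R$ the differentials $d\Delta_1,d\Delta_2,d\Delta_3$ are linearly independent if and only if $\Delta_1\neq0$ at that point. (iii) Let $U\subset\Sigma$ be open, let $\mathcal I$ be an $I(\mathbb R^2_1)$-invariant on $U$, and let $p\in U\cap R$ with $\Delta_1(p)\neq 0$. Then there is a function $F$, analytic near $(\Delta_1,\Delta_2,\Delta_3)(p)$, with $\mathcal I=F(\Delta_1,\Delta_2,\Delta_3)$ in a neighbourhood of $p$, and the germ of $F$ at $(\Delta_1,\Delta_2,\Delta_3)(p)$ is unique. -/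

import Mathlib

open Filter Topology
open scoped ContDiff Matrix

noncomputable section

/-- Partial derivatives on the Minkowski plane with pseudo-Cartesian coordinates `(t, x)`;
index `0` is `t`, index `1` is `x`. -/
def partialDeriv (k : Fin 2) (f : ℝ × ℝ → ℝ) (p : ℝ × ℝ) : ℝ :=
  fderiv ℝ f p (![((1 : ℝ), (0 : ℝ)), (0, 1)] k)

/-- The diagonal of the contravariant Minkowski metric `diag(1, -1)`. -/
def minkowskiDiag : Fin 2 → ℝ := ![1, -1]

/-- `K` is a Killing two-tensor of the Minkowski plane: a smooth symmetric `(2,0)`-tensor with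
`[K, g] = 0`, that is (the metric having constant components)
`g^{kl} ∂_l K^{ij} + g^{il} ∂_l K^{jk} + g^{jl} ∂_l K^{ki} = 0`. -/
def IsKillingTwoTensor (K : ℝ × ℝ → Matrix (Fin 2) (Fin 2) ℝ) : Prop :=
  (∀ i j, ContDiff ℝ ∞ fun p => K p i j) ∧ (∀ p i j, K p i j = K p j i) ∧
    ∀ p i j k,
      minkowskiDiag k * partialDeriv k (fun q => K q i j) p
        + minkowskiDiag i * partialDeriv i (fun q => K q j k) p
        + minkowskiDiag j * partialDeriv j (fun q => K q k i) p = 0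

/-- The Killing two-tensor with parameters `a = (a₀, …, a₅)`. -/
def killingTensor (a : Fin 6 → ℝ) (p : ℝ × ℝ) : Matrix (Fin 2) (Fin 2) ℝ :=
  !![a 0 + 2 * a 3 * p.2 + a 5 * p.2 ^ 2, a 1 + a 3 * p.1 + a 4 * p.2 + a 5 * p.1 * p.2;
     a 1 + a 3 * p.1 + a 4 * p.2 + a 5 * p.1 * p.2, a 2 + 2 * a 4 * p.1 + a 5 * p.1 ^ 2]

/-- An element of the connected isometry group `I(ℝ²₁)`, in the coordinates `(φ, a, b)`. -/
structure MinkowskiIsometry where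
  rapidity : ℝ
  shiftT : ℝ
  shiftX : ℝ

/-- The linear part of an isometry: a hyperbolic rotation. -/
def MinkowskiIsometry.linear (g : MinkowskiIsometry) : Matrix (Fin 2) (Fin 2) ℝ :=
  !![Real.cosh g.rapidity, Real.sinh g.rapidity; Real.sinh g.rapidity, Real.cosh g.rapidity]

/-- The action of an isometry on the Minkowski plane. -/
def MinkowskiIsometry.act (g : MinkowskiIsometry) (p : ℝ × ℝ) : ℝ × ℝ :=
  (Real.cosh g.rapidity * p.1 + Real.sinh g.rapidity * p.2 + g.shiftT,
   Real.sinh g.rapidity * p.1 + Real.cosh g.rapidity * p.2 + g.shiftX)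

/-- The induced action of an isometry on the parameter space. -/
def MinkowskiIsometry.transform (g : MinkowskiIsometry) (a : Fin 6 → ℝ) : Fin 6 → ℝ :=
  let c := Real.cosh g.rapidity
  let s := Real.sinh g.rapidity
  ![a 0 * c ^ 2 + 2 * a 1 * c * s + a 2 * s ^ 2 + a 5 * g.shiftX ^ 2
      - 2 * (a 3 * c + a 4 * s) * g.shiftX,
    a 1 * (c ^ 2 + s ^ 2) + (a 0 + a 2) * c * s
      - (g.shiftT * a 3 + g.shiftX * a 4) * c - (g.shiftT * a 4 + g.shiftX * a 3) * s
      + a 5 * g.shiftT * g.shiftX,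
    a 0 * s ^ 2 + 2 * a 1 * c * s + a 2 * c ^ 2 + a 5 * g.shiftT ^ 2
      - 2 * (a 4 * c + a 3 * s) * g.shiftT,
    a 3 * c + a 4 * s - a 5 * g.shiftX,
    a 3 * s + a 4 * c - a 5 * g.shiftT,
    a 5]

/-- Lie derivative along a vector field `X` of a `(2,0)`-tensor field `K`, in components. -/
def lieDerivative (X : ℝ × ℝ → Fin 2 → ℝ) (K : ℝ × ℝ → Matrix (Fin 2) (Fin 2) ℝ)
    (p : ℝ × ℝ) : Matrix (Fin 2) (Fin 2) ℝ :=
  Matrix.of fun i j => ∑ k, (X p k * partialDeriv k (fun q => K q i j) p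
    - K p k j * partialDeriv k (fun q => X q i) p
    - K p i k * partialDeriv k (fun q => X q j) p)

/-- The Killing vectors `T = ∂_t`, `X = ∂_x`, `H = x ∂_t + t ∂_x`. -/
def killingVector : Fin 3 → ℝ × ℝ → Fin 2 → ℝ :=
  ![fun _ => ![1, 0], fun _ => ![0, 1], fun p => ![p.2, p.1]]

/-- The three generators `V₁, V₂, V₃` of the induced action on the parameter space. -/
def generator : Fin 3 → (Fin 6 → ℝ) → Fin 6 → ℝ :=
  ![fun a => ![0, a 3, 2 * a 4, 0, a 5, 0],
    fun a => ![2 * a 3, a 4, 0, a 5, 0, 0],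
    fun a => ![-2 * a 1, -(a 0 + a 2), -2 * a 1, -a 4, -a 3, 0]]

/-- The region of the parameter space where the generators are linearly independent. -/
def regularRegion : Set (Fin 6 → ℝ) :=
  {a | LinearIndependent ℝ fun i => generator i a}

/-- `f` is, on `U`, an `I(ℝ²₁)`-invariant (regularity is required separately). -/
def IsInvariantOn (U : Set (Fin 6 → ℝ)) (f : (Fin 6 → ℝ) → ℝ) : Prop :=
  ∀ g : MinkowskiIsometry, ∀ a ∈ U, g.transform a ∈ U → f (g.transform a) = f a

/-- `(Δ₁, Δ₂, Δ₃)`. -/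
def fundInvariants (a : Fin 6 → ℝ) : Fin 3 → ℝ :=
  ![a 5,
    (a 0 - a 2) * a 5 - a 3 ^ 2 + a 4 ^ 2,
    (a 3 ^ 2 + a 4 ^ 2 - a 5 * (a 0 + a 2)) ^ 2 - 4 * (a 5 * a 1 - a 3 * a 4) ^ 2]

/-- The parameters of the transformed tensor are those given by the tensor transformation law. -/
theorem killingTensor_act_iff (g : MinkowskiIsometry) (a b : Fin 6 → ℝ) :
    (∀ p, killingTensor b (g.act p) = g.linear * killingTensor a p * g.linearᵀ) ↔
      b = g.transform a := by
  have inj : ∀ b b' : Fin 6 → ℝ, (∀ q, killingTensor b q = killingTensor b' q) → b = b' := by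
    intro b b' h
    have e (q : ℝ × ℝ) (i j : Fin 2) := congrFun (congrFun (h q) i) j
    have h1 := e (0, 0) 0 0
    have h2 := e (0, 1) 0 0
    have h3 := e (0, -1) 0 0
    have h4 := e (0, 0) 0 1
    have h5 := e (0, 0) 1 1
    have h6 := e (0, 1) 0 1
    simp [killingTensor] at h1 h2 h3 h4 h5 h6
    funext i
    fin_cases i <;> simp <;> linarith
  have key : ∀ p, killingTensor (g.transform a) (g.act p)
      = g.linear * killingTensor a p * g.linearᵀ := by
    intro p
    have hc := Real.cosh_sq g.rapidity
    ext i j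
    fin_cases i <;> fin_cases j <;>
      simp [killingTensor, MinkowskiIsometry.transform, MinkowskiIsometry.act,
        MinkowskiIsometry.linear, Matrix.mul_apply, Fin.sum_univ_two] <;>
      generalize Real.cosh g.rapidity = c at * <;>
      generalize Real.sinh g.rapidity = s at * <;> ring
  constructor
  · intro h
    refine inj _ _ fun q => ?_
    have hq : ∃ p, g.act p = q := by
      have hc := Real.cosh_sq g.rapidity
      refine ⟨(Real.cosh g.rapidity * (q.1 - g.shiftT) - Real.sinh g.rapidity * (q.2 - g.shiftX),
        -Real.sinh g.rapidity * (q.1 - g.shiftT) + Real.cosh g.rapidity * (q.2 - g.shiftX)), ?_⟩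
      ext
      · simp only [MinkowskiIsometry.act]
        linear_combination (q.1 - g.shiftT) * hc
      · simp only [MinkowskiIsometry.act]
        linear_combination (q.2 - g.shiftX) * hc
    obtain ⟨p, rfl⟩ := hq
    rw [h p, key p]
  · rintro rfl p
    exact key p

theorem partialDeriv_zero_of {f : ℝ × ℝ → ℝ} {p : ℝ × ℝ} {d : ℝ} (hf : DifferentiableAt ℝ f p)
    (h : HasDerivAt (fun t => f (t, p.2)) d p.1) : partialDeriv 0 f p = d := by
  have h2 : HasDerivAt (fun t : ℝ => (t, p.2)) ((1 : ℝ), (0 : ℝ)) p.1 :=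
    (hasDerivAt_id p.1).prodMk (hasDerivAt_const p.1 p.2)
  exact (HasFDerivAt.comp_hasDerivAt (f := fun t : ℝ => (t, p.2)) p.1
    (hf.hasFDerivAt : HasFDerivAt f _ (p.1, p.2)) h2).unique h

theorem partialDeriv_one_of {f : ℝ × ℝ → ℝ} {p : ℝ × ℝ} {d : ℝ} (hf : DifferentiableAt ℝ f p)
    (h : HasDerivAt (fun x => f (p.1, x)) d p.2) : partialDeriv 1 f p = d := by
  have h2 : HasDerivAt (fun x : ℝ => (p.1, x)) ((0 : ℝ), (1 : ℝ)) p.2 :=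
    (hasDerivAt_const p.2 p.1).prodMk (hasDerivAt_id p.2)
  exact (HasFDerivAt.comp_hasDerivAt (f := fun x : ℝ => (p.1, x)) p.2
    (hf.hasFDerivAt : HasFDerivAt f _ (p.1, p.2)) h2).unique h

theorem hasDerivAt_partialDeriv_zero {f : ℝ × ℝ → ℝ} (hf : Differentiable ℝ f) (t x : ℝ) :
    HasDerivAt (fun t => f (t, x)) (partialDeriv 0 f (t, x)) t :=
  HasFDerivAt.comp_hasDerivAt (f := fun t : ℝ => (t, x)) t (hf (t, x)).hasFDerivAt
    ((hasDerivAt_id t).prodMk (hasDerivAt_const t x))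

theorem hasDerivAt_partialDeriv_one {f : ℝ × ℝ → ℝ} (hf : Differentiable ℝ f) (t x : ℝ) :
    HasDerivAt (fun x => f (t, x)) (partialDeriv 1 f (t, x)) x :=
  HasFDerivAt.comp_hasDerivAt (f := fun x : ℝ => (t, x)) x (hf (t, x)).hasFDerivAt
    ((hasDerivAt_const x t).prodMk (hasDerivAt_id x))

theorem hasDerivAt_quadratic (α β γ x : ℝ) :
    HasDerivAt (fun x => α + β * x + γ * x ^ 2) (β + 2 * γ * x) x := by
  have h := (((hasDerivAt_id x).const_mul β).const_add α).add
    (((hasDerivAt_id x).pow 2).const_mul γ)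
  refine (h.congr_deriv ?_)
  simp
  ring

theorem eq_quadratic {h : ℝ → ℝ} {β γ : ℝ} (hd : ∀ x, HasDerivAt h (β + 2 * γ * x) x) (x : ℝ) :
    h x = h 0 + β * x + γ * x ^ 2 := by
  have e : ∀ y, HasDerivAt (fun y => h y - (0 + β * y + γ * y ^ 2)) 0 y := fun y =>
    ((hd y).sub (hasDerivAt_quadratic 0 β γ y)).congr_deriv (by ring)
  have := is_const_of_deriv_eq_zero (fun y => (e y).differentiableAt) (fun y => (e y).deriv) x 0
  simp at this
  linarith

theorem contDiff_killingTensor (a : Fin 6 → ℝ) (i j : Fin 2) :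
    ContDiff ℝ ∞ fun p => killingTensor a p i j := by
  fin_cases i <;> fin_cases j <;> simp [killingTensor] <;> fun_prop

/-- The partial derivatives of the components of `killingTensor a`. -/
theorem partialDeriv_killingTensor (a : Fin 6 → ℝ) (p : ℝ × ℝ) (k i j : Fin 2) :
    partialDeriv k (fun q => killingTensor a q i j) p =
      (![!![0, a 3 + a 5 * p.2; a 3 + a 5 * p.2, 2 * a 4 + 2 * a 5 * p.1],
         !![2 * a 3 + 2 * a 5 * p.2, a 4 + a 5 * p.1; a 4 + a 5 * p.1, 0]] k :
          Matrix (Fin 2) (Fin 2) ℝ) i j := by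
  have hd := ((contDiff_killingTensor a i j).differentiable (by simp)) p
  fin_cases k
  · refine partialDeriv_zero_of hd ?_
    fin_cases i <;> fin_cases j <;> simp [killingTensor]
    · exact hasDerivAt_const _ _
    · exact ((hasDerivAt_quadratic (a 1 + a 4 * p.2) (a 3 + a 5 * p.2) 0 p.1).congr_deriv
        (by ring)).congr_of_eventuallyEq (.of_forall fun t => by ring)
    · exact ((hasDerivAt_quadratic (a 1 + a 4 * p.2) (a 3 + a 5 * p.2) 0 p.1).congr_deriv
        (by ring)).congr_of_eventuallyEq (.of_forall fun t => by ring)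
    · exact hasDerivAt_quadratic _ _ _ _
  · refine partialDeriv_one_of hd ?_
    fin_cases i <;> fin_cases j <;> simp [killingTensor]
    · exact hasDerivAt_quadratic _ _ _ _
    · exact ((hasDerivAt_quadratic (a 1 + a 3 * p.1) (a 4 + a 5 * p.1) 0 p.2).congr_deriv
        (by ring)).congr_of_eventuallyEq (.of_forall fun t => by ring)
    · exact ((hasDerivAt_quadratic (a 1 + a 3 * p.1) (a 4 + a 5 * p.1) 0 p.2).congr_deriv
        (by ring)).congr_of_eventuallyEq (.of_forall fun t => by ring)
    · exact hasDerivAt_const _ _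

/-- The Killing two-tensors of the Minkowski plane are exactly the tensors `killingTensor a`. -/
theorem isKillingTwoTensor_iff (K : ℝ × ℝ → Matrix (Fin 2) (Fin 2) ℝ) :
    IsKillingTwoTensor K ↔ ∃ a, K = killingTensor a := by
  constructor
  · rintro ⟨hs, hsym, hk⟩
    have hd := fun i j => (hs i j).differentiable (by simp)
    have e1 : ∀ p, partialDeriv 0 (fun q => K q 0 0) p = 0 := fun p => by
      have := hk p 0 0 0; simp [minkowskiDiag] at this; linarith
    have e4 : ∀ p, partialDeriv 1 (fun q => K q 1 1) p = 0 := fun p => by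
      have := hk p 1 1 1; simp [minkowskiDiag] at this; linarith
    have s10 : (fun q => K q 1 0) = fun q => K q 0 1 := funext fun q => hsym q 1 0
    have e2 : ∀ p, partialDeriv 1 (fun q => K q 0 0) p
        = 2 * partialDeriv 0 (fun q => K q 0 1) p := fun p => by
      have := hk p 0 0 1; simp [minkowskiDiag, s10] at this; linarith
    have e3 : ∀ p, partialDeriv 0 (fun q => K q 1 1) p
        = 2 * partialDeriv 1 (fun q => K q 0 1) p := fun p => by
      have := hk p 1 1 0; simp [minkowskiDiag, s10] at this; linarith
    have c1 : ∀ t x, K (t, x) 0 0 = K (0, x) 0 0 := fun t x => by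
      have := eq_quadratic (h := fun t => K (t, x) 0 0) (β := 0) (γ := 0)
        (fun t => (hasDerivAt_partialDeriv_zero (hd 0 0) t x).congr_deriv (by simp [e1])) t
      simpa using this
    have c2 : ∀ t x, K (t, x) 1 1 = K (t, 0) 1 1 := fun t x => by
      have := eq_quadratic (h := fun x => K (t, x) 1 1) (β := 0) (γ := 0)
        (fun x => (hasDerivAt_partialDeriv_one (hd 1 1) t x).congr_deriv (by simp [e4])) x
      simpa using this
    set f' : ℝ → ℝ := fun x => partialDeriv 1 (fun q => K q 0 0) (0, x) with hf'
    set g' : ℝ → ℝ := fun t => partialDeriv 0 (fun q => K q 1 1) (t, 0) with hg'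
    have d1 : ∀ t x, partialDeriv 1 (fun q => K q 0 0) (t, x) = f' x := fun t x =>
      (hasDerivAt_partialDeriv_one (hd 0 0) t x).unique
        ((hasDerivAt_partialDeriv_one (hd 0 0) 0 x).congr_of_eventuallyEq
          (.of_forall fun y => c1 t y))
    have d2 : ∀ t x, partialDeriv 0 (fun q => K q 1 1) (t, x) = g' t := fun t x =>
      (hasDerivAt_partialDeriv_zero (hd 1 1) t x).unique
        ((hasDerivAt_partialDeriv_zero (hd 1 1) t 0).congr_of_eventuallyEq
          (.of_forall fun y => c2 y x))
    have b1 : ∀ t x, K (t, x) 0 1 = K (0, x) 0 1 + f' x / 2 * t := fun t x => by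
      have := eq_quadratic (h := fun t => K (t, x) 0 1) (β := f' x / 2) (γ := 0)
        (fun t => (hasDerivAt_partialDeriv_zero (hd 0 1) t x).congr_deriv
          (by have := e2 (t, x); rw [d1] at this; linarith)) t
      simpa using this
    have b2 : ∀ t x, K (t, x) 0 1 = K (t, 0) 0 1 + g' t / 2 * x := fun t x => by
      have := eq_quadratic (h := fun x => K (t, x) 0 1) (β := g' t / 2) (γ := 0)
        (fun x => (hasDerivAt_partialDeriv_one (hd 0 1) t x).congr_deriv
          (by have := e3 (t, x); rw [d2] at this; linarith)) x
      simpa using this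
    have b3 : ∀ t x, f' 0 / 2 * t + g' t / 2 * x = g' 0 / 2 * x + f' x / 2 * t := fun t x => by
      have h1 := b1 t x
      have h2 := b2 t x
      have h3 := b1 t 0
      have h4 := b2 0 x
      linarith
    have q1 : ∀ x, f' x = f' 0 + 2 * ((g' 1 - g' 0) / 2) * x := fun x => by
      have := b3 1 x; linarith
    have q2 : ∀ t, g' t = g' 0 + 2 * ((g' 1 - g' 0) / 2) * t := fun t => by
      have h1 := b3 t 1; have h2 := q1 1; rw [h2] at h1; linarith
    have r1 : ∀ x, K (0, x) 0 0 = K (0, 0) 0 0 + f' 0 * x + (g' 1 - g' 0) / 2 * x ^ 2 :=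
      eq_quadratic fun x => (hasDerivAt_partialDeriv_one (hd 0 0) 0 x).congr_deriv (q1 x)
    have r2 : ∀ t, K (t, 0) 1 1 = K (0, 0) 1 1 + g' 0 * t + (g' 1 - g' 0) / 2 * t ^ 2 :=
      eq_quadratic fun t => (hasDerivAt_partialDeriv_zero (hd 1 1) t 0).congr_deriv (q2 t)
    have r3 : ∀ t x, K (t, x) 0 1
        = K (0, 0) 0 1 + f' 0 / 2 * t + g' 0 / 2 * x + (g' 1 - g' 0) / 2 * t * x := fun t x => by
      rw [b1, b2 0 x, q1 x]; ring
    refine ⟨![K (0, 0) 0 0, K (0, 0) 0 1, K (0, 0) 1 1, f' 0 / 2, g' 0 / 2,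
      (g' 1 - g' 0) / 2], ?_⟩
    funext ⟨t, x⟩
    ext i j
    fin_cases i <;> fin_cases j <;> simp [killingTensor]
    · rw [c1, r1]; ring
    · rw [r3]
    · rw [hsym, r3]
    · rw [c2, r2]; ring
  · rintro ⟨a, rfl⟩
    refine ⟨contDiff_killingTensor a, fun p i j => ?_, fun p i j k => ?_⟩
    · fin_cases i <;> fin_cases j <;> simp [killingTensor]
    · simp only [partialDeriv_killingTensor]
      fin_cases i <;> fin_cases j <;> fin_cases k <;> simp [minkowskiDiag] <;> ring

/-- The generators are the Lie derivatives of the Killing tensor along the Killing vectors,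
read in the parameter space. -/
theorem lieDerivative_killingTensor (i : Fin 3) (a : Fin 6 → ℝ) :
    lieDerivative (killingVector i) (killingTensor a) = killingTensor (generator i a) := by
  have fst0 : ∀ p, partialDeriv 0 (fun q => q.1) p = 1 := fun p => by
    change fderiv ℝ Prod.fst p _ = _
    simp [fderiv_fst]
  have fst1 : ∀ p, partialDeriv 1 (fun q => q.1) p = 0 := fun p => by
    change fderiv ℝ Prod.fst p _ = _
    simp [fderiv_fst]
  have snd0 : ∀ p, partialDeriv 0 (fun q => q.2) p = 0 := fun p => by
    change fderiv ℝ Prod.snd p _ = _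
    simp [fderiv_snd]
  have snd1 : ∀ p, partialDeriv 1 (fun q => q.2) p = 1 := fun p => by
    change fderiv ℝ Prod.snd p _ = _
    simp [fderiv_snd]
  have const : ∀ k (c : ℝ) p, partialDeriv k (fun _ => c) p = 0 := fun k c p => by
    simp [partialDeriv]
  funext p
  ext j k
  fin_cases i <;> fin_cases j <;> fin_cases k <;>
    simp [lieDerivative, killingVector, generator, Fin.sum_univ_two, partialDeriv_killingTensor,
      fst0, fst1, snd0, snd1, const] <;>
    simp [killingTensor] <;> ring

end

/-! Where `a₅ ≠ 0` the tensor has a centre `(-a₄/a₅, -a₃/a₅)`, which isometries carry along, so only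
its components at the centre matter. Multiplied by `a₅`, they are encoded by their Minkowski trace
`Δ₂` and two null components `P_±` (`nullCoordinate`), obtained by contracting with the covectors
`(1, ±1)` twice. A boost of rapidity `φ` fixes `Δ₁` and `Δ₂`, and scales `P_±` by `exp (±2φ)`; hence
`Δ₃ = P₊ P₋` is invariant.

On the regular region with `a₅ ≠ 0` some `P_ε` is nonzero (`exists_nullCoordinate_ne_zero`). This
gives independence of the differentials. It also makes orbits, locally, the level sets of `Δ`
(`exists_transform_eq`): a boost adjusts `P_ε`, then `Δ₃` determines `P_{-ε}` and a translation
matches the centres. A local analytic section `σ` of `Δ` then gives `F = I ∘ σ`, because `a` and `σ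
(Δ a)` share an orbit; uniqueness follows from `Δ ∘ σ = id`. -/

/-- For `ε = ±1`, a null coordinate on the two-dimensional space on which the boosts act
faithfully after the translations have been divided out: a boost of rapidity `φ` multiplies it by
`exp (2 ε φ)`. -/
noncomputable def nullCoordinate (ε : ℝ) (a : Fin 6 → ℝ) : ℝ :=
  (a 0 + a 2) * a 5 - a 3 ^ 2 - a 4 ^ 2 + 2 * ε * (a 1 * a 5 - a 3 * a 4)

theorem fundInvariants_two_eq_mul_nullCoordinate {ε : ℝ} (hε : ε ^ 2 = 1) (a : Fin 6 → ℝ) :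
    fundInvariants a 2 = nullCoordinate ε a * nullCoordinate (-ε) a := by
  simp only [fundInvariants, nullCoordinate, Matrix.cons_val]
  linear_combination 4 * (a 1 * a 5 - a 3 * a 4) ^ 2 * hε

theorem nullCoordinate_transform {ε : ℝ} (hε : ε ^ 2 = 1) (g : MinkowskiIsometry)
    (a : Fin 6 → ℝ) :
    nullCoordinate ε (g.transform a)
      = (Real.cosh g.rapidity + ε * Real.sinh g.rapidity) ^ 2 * nullCoordinate ε a := by
  simp only [nullCoordinate, MinkowskiIsometry.transform, Matrix.cons_val]
  generalize Real.cosh g.rapidity = c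
  generalize Real.sinh g.rapidity = s
  linear_combination (4 * c * s * (a 3 * a 4 - a 1 * a 5)
    - s ^ 2 * ((a 0 + a 2) * a 5 - a 3 ^ 2 - a 4 ^ 2 + 2 * ε * (a 1 * a 5 - a 3 * a 4))) * hε

theorem isInvariantOn_fundInvariants (i : Fin 3) :
    IsInvariantOn Set.univ fun a => fundInvariants a i := by
  intro g a _ _
  have hc := Real.cosh_sq g.rapidity
  fin_cases i
  · simp [fundInvariants, MinkowskiIsometry.transform]
  · simp only [fundInvariants, MinkowskiIsometry.transform, Matrix.cons_val, Fin.mk_one]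
    linear_combination ((a 0 - a 2) * a 5 - a 3 ^ 2 + a 4 ^ 2) * hc
  · change fundInvariants _ 2 = fundInvariants _ 2
    rw [fundInvariants_two_eq_mul_nullCoordinate (one_pow 2),
      fundInvariants_two_eq_mul_nullCoordinate (one_pow 2),
      nullCoordinate_transform (by norm_num), nullCoordinate_transform (by norm_num)]
    generalize Real.cosh g.rapidity = c at *
    generalize Real.sinh g.rapidity = s at *
    linear_combination (nullCoordinate 1 a * nullCoordinate (-1) a * (c ^ 2 - s ^ 2 + 1)) * hc

/-- The null coordinates do not vanish simultaneously on the regular region off `a₅ = 0`. -/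
theorem exists_nullCoordinate_ne_zero {a : Fin 6 → ℝ} (ha : a ∈ regularRegion) (h5 : a 5 ≠ 0) :
    ∃ ε : ℝ, ε ^ 2 = 1 ∧ nullCoordinate ε a ≠ 0 := by
  by_contra! h
  have h1 := h 1 (by norm_num)
  have h2 := h (-1) (by norm_num)
  simp only [nullCoordinate] at h1 h2
  -- `a₃ V₁ + a₄ V₂ + a₅ V₃` generates the boosts about the centre; its components are combinations
  -- of the two null coordinates.
  have key := Fintype.linearIndependent_iff.1 ha ![a 3, a 4, a 5] (by
    funext j
    fin_cases j <;> simp [Fin.sum_univ_three, generator] <;> linarith) 2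
  exact h5 key

/-! ### Differentials of the invariants -/

theorem fderiv_fundInvariants_zero (x v : Fin 6 → ℝ) :
    fderiv ℝ (fun a => fundInvariants a 0) x v = v 5 := by
  have h : HasFDerivAt (fun a => fundInvariants a 0) _ x := hasFDerivAt_apply (𝕜 := ℝ) 5 x
  rw [h.fderiv]
  simp

theorem fderiv_fundInvariants_one (x v : Fin 6 → ℝ) :
    fderiv ℝ (fun a => fundInvariants a 1) x v
      = (v 0 - v 2) * x 5 + (x 0 - x 2) * v 5 - 2 * x 3 * v 3 + 2 * x 4 * v 4 := by
  have p (j : Fin 6) := hasFDerivAt_apply (𝕜 := ℝ) (F' := fun _ : Fin 6 => ℝ) j x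
  have h : HasFDerivAt (fun a => fundInvariants a 1) _ x :=
    ((((p 0).sub (p 2)).mul (p 5)).sub ((p 3).pow 2)).add ((p 4).pow 2)
  rw [h.fderiv]
  simp
  ring

theorem fderiv_fundInvariants_two (x v : Fin 6 → ℝ) :
    fderiv ℝ (fun a => fundInvariants a 2) x v
      = 2 * (x 3 ^ 2 + x 4 ^ 2 - x 5 * (x 0 + x 2))
          * (2 * x 3 * v 3 + 2 * x 4 * v 4 - v 5 * (x 0 + x 2) - x 5 * (v 0 + v 2))
        - 8 * (x 5 * x 1 - x 3 * x 4) * (v 5 * x 1 + x 5 * v 1 - v 3 * x 4 - x 3 * v 4) := by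
  have p (j : Fin 6) := hasFDerivAt_apply (𝕜 := ℝ) (F' := fun _ : Fin 6 => ℝ) j x
  have h : HasFDerivAt (fun a => fundInvariants a 2) _ x :=
    (((((p 3).pow 2).add ((p 4).pow 2)).sub ((p 5).mul ((p 0).add (p 2)))).pow 2).sub
      (((((p 5).mul (p 1)).sub ((p 3).mul (p 4))).pow 2).const_mul 4)
  rw [h.fderiv]
  simp
  ring

theorem linearIndependent_fderiv_fundInvariants_iff {x : Fin 6 → ℝ} (hx : x ∈ regularRegion) :
    (LinearIndependent ℝ fun i : Fin 3 => fderiv ℝ (fun a => fundInvariants a i) x) ↔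
      x 5 ≠ 0 := by
  rw [Fintype.linearIndependent_iff]
  have eval (g : Fin 3 → ℝ) (v : Fin 6 → ℝ) :
      (∑ i, g i • fderiv ℝ (fun a => fundInvariants a i) x) v
        = g 0 * fderiv ℝ (fun a => fundInvariants a 0) x v
          + g 1 * fderiv ℝ (fun a => fundInvariants a 1) x v
          + g 2 * fderiv ℝ (fun a => fundInvariants a 2) x v := by
    simp [Fin.sum_univ_three]
  simp only [fderiv_fundInvariants_zero, fderiv_fundInvariants_one,
    fderiv_fundInvariants_two] at eval
  constructor
  · intro h h5
    -- On `a₅ = 0` one has `Δ₃ = Δ₂²`, so there `dΔ₃ - 2 Δ₂ dΔ₂` is a multiple of `dΔ₁`; the first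
    -- coefficient cancels that multiple.
    have := h ![2 * (x 3 ^ 2 + x 4 ^ 2) * (x 0 + x 2) - 8 * x 3 * x 4 * x 1
      - 2 * (x 3 ^ 2 - x 4 ^ 2) * (x 0 - x 2), 2 * (x 3 ^ 2 - x 4 ^ 2), 1] (by
        ext1 v
        rw [eval]
        simp [h5]
        ring) 2
    simp at this
  · intro h5 g hg
    have e (v : Fin 6 → ℝ) := (eval g v).symm.trans (by simp [hg] : _ = (0 : ℝ))
    have e0 := e ![1, 0, 0, 0, 0, 0]
    have e1 := e ![0, 1, 0, 0, 0, 0]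
    have e2 := e ![0, 0, 1, 0, 0, 0]
    have e5 := e ![0, 0, 0, 0, 0, 1]
    simp only [Matrix.cons_val] at e0 e1 e2 e5
    have g1 : g 1 = 0 := by
      refine (mul_eq_zero.1 ?_).resolve_right h5
      linear_combination (e0 - e2) / 2
    have g2 : g 2 = 0 := by
      obtain ⟨ε, -, hP⟩ := exists_nullCoordinate_ne_zero hx h5
      -- The combination of the `a₀`, `a₁`, `a₂` directions chosen here kills `dΔ₁` and `dΔ₂`, and
      -- pairs with `dΔ₃` to a multiple of `a₅ P_ε`.
      refine (mul_eq_zero.1 ?_).resolve_right (mul_ne_zero h5 hP)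
      simp only [nullCoordinate]
      linear_combination (e0 + e2) / 4 - ε * e1 / 4
    have g0 : g 0 = 0 := by
      simpa [g1, g2] using e5
    intro i
    fin_cases i
    exacts [g0, g1, g2]

/-! ### Orbits off `a₅ = 0` -/

theorem exists_cosh_add_mul_sinh_sq_eq {ε r : ℝ} (hε : ε ^ 2 = 1) (hr : 0 < r) :
    ∃ φ, (Real.cosh φ + ε * Real.sinh φ) ^ 2 = r := by
  have h : (Real.cosh (Real.log r / 2) + Real.sinh (Real.log r / 2)) ^ 2 = r := by
    rw [Real.cosh_add_sinh, ← Real.exp_nat_mul]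
    norm_num [mul_div_cancel₀, Real.exp_log hr]
  rcases mul_self_eq_one_iff.1 ((sq ε).symm.trans hε) with rfl | rfl
  · exact ⟨_, by simpa using h⟩
  · exact ⟨-(Real.log r / 2), by simpa using h⟩

/-- Two parameters with equal fundamental invariants, off `a₅ = 0`, lie on the same orbit as soon
as one of their null coordinates has the same sign. -/
theorem exists_transform_eq {ε : ℝ} (hε : ε ^ 2 = 1) {a b : Fin 6 → ℝ} (h5 : a 5 ≠ 0)
    (hab : fundInvariants a = fundInvariants b)
    (hP : 0 < nullCoordinate ε b / nullCoordinate ε a) :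
    ∃ g : MinkowskiIsometry, g.transform a = b := by
  obtain ⟨φ, hφ⟩ := exists_cosh_add_mul_sinh_sq_eq hε hP
  have hPa : nullCoordinate ε a ≠ 0 := fun h => by simp [h] at hP
  have hPb : nullCoordinate ε b ≠ 0 := fun h => by simp [h] at hP
  have hc := Real.cosh_sq φ
  have hk : a 5 = b 5 := congrFun hab 0
  have h1 := congrFun hab 1
  have h2 := congrFun hab 2
  rw [fundInvariants_two_eq_mul_nullCoordinate hε,
    fundInvariants_two_eq_mul_nullCoordinate hε] at h2
  -- The shifts are forced by matching the components `a₃` and `a₄`, that is, the centres.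
  refine ⟨⟨φ, (a 3 * Real.sinh φ + a 4 * Real.cosh φ - b 4) / a 5,
    (a 3 * Real.cosh φ + a 4 * Real.sinh φ - b 3) / a 5⟩, ?_⟩
  simp only [MinkowskiIsometry.transform]
  generalize Real.cosh φ = c at *
  generalize Real.sinh φ = s at *
  rw [eq_div_iff hPa] at hφ
  -- Equality of `Δ₃` transfers the scaling to the other null coordinate, with the inverse factor;
  -- that coordinate may vanish.
  have hφ' : nullCoordinate (-ε) b = (c - ε * s) ^ 2 * nullCoordinate (-ε) a := by
    refine mul_left_cancel₀ hPb ?_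
    have hn : (c + ε * s) * (c - ε * s) = 1 := by linear_combination hc - s ^ 2 * hε
    rw [← h2, ← hφ]
    linear_combination (-(nullCoordinate ε a * nullCoordinate (-ε) a)
      * ((c + ε * s) * (c - ε * s) + 1)) * hn
  simp only [nullCoordinate] at hφ hφ'
  simp only [fundInvariants, Matrix.cons_val] at h1
  rw [← hk] at hφ hφ' h1
  -- Half the sum and the signed difference of the null coordinates recover the components at the
  -- centre; `Δ₂` then separates `a₀` from `a₂`.
  have hp : (b 0 + b 2) * a 5 - b 3 ^ 2 - b 4 ^ 2
      = (c ^ 2 + s ^ 2) * ((a 0 + a 2) * a 5 - a 3 ^ 2 - a 4 ^ 2)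
        + 4 * c * s * (a 1 * a 5 - a 3 * a 4) := by
    linear_combination (hφ' - hφ) / 2 + (s ^ 2 * ((a 0 + a 2) * a 5 - a 3 ^ 2 - a 4 ^ 2)
        + 4 * c * s * (a 1 * a 5 - a 3 * a 4)) * hε
  have hv : b 1 * a 5 - b 3 * b 4 = (c ^ 2 + s ^ 2) * (a 1 * a 5 - a 3 * a 4)
        + c * s * ((a 0 + a 2) * a 5 - a 3 ^ 2 - a 4 ^ 2) := by
    linear_combination -ε / 4 * (hφ + hφ') + (-(b 1 * a 5 - b 3 * b 4)
      + c * s * ((a 0 + a 2) * a 5 - a 3 ^ 2 - a 4 ^ 2)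
      + (c ^ 2 + (ε ^ 2 + 1) * s ^ 2) * (a 1 * a 5 - a 3 * a 4)) * hε
  funext j
  fin_cases j
  · simp only [Matrix.cons_val, Fin.zero_eta]
    field_simp
    linear_combination -(hp - h1) / 2 + ((a 0 - a 2) * a 5 - a 3 ^ 2 + a 4 ^ 2) / 2 * hc
  · simp only [Matrix.cons_val, Fin.mk_one]
    field_simp
    linear_combination -hv
  · simp only [Matrix.cons_val, Fin.reduceFinMk]
    field_simp
    linear_combination -(hp + h1) / 2 - ((a 0 - a 2) * a 5 - a 3 ^ 2 + a 4 ^ 2) / 2 * hc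
  · simp only [Matrix.cons_val, Fin.reduceFinMk]
    field_simp
    ring
  · simp only [Matrix.cons_val, Fin.reduceFinMk]
    field_simp
    ring
  · exact hk

/-! ### An analytic local section -/

/-- A local section of `fundInvariants` through `x`, along which `a₃`, `a₄` and one null
coordinate are constant. -/
noncomputable def invariantSection (ε : ℝ) (x : Fin 6 → ℝ) (d : Fin 3 → ℝ) : Fin 6 → ℝ :=
  ![((nullCoordinate ε x + d 2 / nullCoordinate ε x) / 4 + d 1 / 2 + x 3 ^ 2) / d 0,
    (ε * (nullCoordinate ε x - d 2 / nullCoordinate ε x) / 4 + x 3 * x 4) / d 0,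
    ((nullCoordinate ε x + d 2 / nullCoordinate ε x) / 4 - d 1 / 2 + x 4 ^ 2) / d 0,
    x 3, x 4, d 0]

section invariantSection

variable {ε : ℝ} {x : Fin 6 → ℝ} {d : Fin 3 → ℝ}

/-- The section solves for `a₀, a₁, a₂` so that `P_ε` keeps its value `P` at `x` while `P_{-ε} = d₂
/ P`; the free `δ` serves both signs. -/
theorem nullCoordinate_invariantSection (δ : ℝ) (hd : d 0 ≠ 0) :
    nullCoordinate δ (invariantSection ε x d)
      = (nullCoordinate ε x + d 2 / nullCoordinate ε x) / 2
        + δ * ε * (nullCoordinate ε x - d 2 / nullCoordinate ε x) / 2 := by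
  rw [nullCoordinate]
  simp only [invariantSection, Matrix.cons_val, add_mul, div_mul_cancel₀ _ hd]
  ring

theorem nullCoordinate_invariantSection_self (hε : ε ^ 2 = 1) (hd : d 0 ≠ 0) :
    nullCoordinate ε (invariantSection ε x d) = nullCoordinate ε x := by
  rw [nullCoordinate_invariantSection ε hd]
  linear_combination (nullCoordinate ε x - d 2 / nullCoordinate ε x) / 2 * hε

theorem fundInvariants_invariantSection (hε : ε ^ 2 = 1) (hP : nullCoordinate ε x ≠ 0)
    (hd : d 0 ≠ 0) : fundInvariants (invariantSection ε x d) = d := by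
  funext i
  fin_cases i
  · rfl
  · simp only [fundInvariants, invariantSection, Matrix.cons_val, Fin.mk_one]
    field_simp
    ring
  · change fundInvariants _ 2 = d 2
    have h : nullCoordinate (-ε) (invariantSection ε x d) = d 2 / nullCoordinate ε x := by
      rw [nullCoordinate_invariantSection (-ε) hd]
      linear_combination -(nullCoordinate ε x - d 2 / nullCoordinate ε x) / 2 * hε
    rw [fundInvariants_two_eq_mul_nullCoordinate hε, nullCoordinate_invariantSection_self hε hd, h,
      mul_div_cancel₀ _ hP]

theorem invariantSection_fundInvariants_self (hε : ε ^ 2 = 1) (hP : nullCoordinate ε x ≠ 0)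
    (hx : x 5 ≠ 0) : invariantSection ε x (fundInvariants x) = x := by
  have h2 : fundInvariants x 2 / nullCoordinate ε x = nullCoordinate (-ε) x := by
    rw [fundInvariants_two_eq_mul_nullCoordinate hε, mul_div_cancel_left₀ _ hP]
  have h0 : fundInvariants x 0 = x 5 := rfl
  rw [invariantSection, h2, h0]
  simp only [nullCoordinate, fundInvariants, Matrix.cons_val]
  funext j
  fin_cases j
  · simp only [Matrix.cons_val, Fin.zero_eta]
    field_simp
    ring
  · simp only [Matrix.cons_val, Fin.mk_one]
    field_simp
    linear_combination 4 * (x 1 * x 5 - x 3 * x 4) * hε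
  · simp only [Matrix.cons_val, Fin.reduceFinMk]
    field_simp
    ring
  all_goals rfl

theorem analyticAt_invariantSection (hd : d 0 ≠ 0) : AnalyticAt ℝ (invariantSection ε x) d := by
  suffices h : ContDiffAt ℝ ω (invariantSection ε x) d from h.analyticAt
  rw [contDiffAt_pi]
  intro j
  -- Division by the constant `P_ε(x)` becomes multiplication, so only `d 0 ≠ 0` has to be
  -- discharged.
  fin_cases j <;> simp only [invariantSection, Matrix.cons_val, Fin.zero_eta, Fin.mk_one,
    Fin.reduceFinMk, div_eq_mul_inv _ (nullCoordinate ε x)] <;>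
    fun_prop (disch := assumption)

end invariantSection

/-! ### Continuity and the main theorem -/

theorem continuous_nullCoordinate (ε : ℝ) : Continuous (nullCoordinate ε) := by
  unfold nullCoordinate
  fun_prop

theorem continuous_fundInvariants : Continuous fundInvariants := by
  refine continuous_pi fun i => ?_
  fin_cases i <;> simp only [fundInvariants, Matrix.cons_val, Fin.zero_eta, Fin.mk_one,
    Fin.reduceFinMk] <;> fun_prop

/-- The functions `Δ₁, Δ₂, Δ₃` are invariants; on the region where the three generators are
linearly independent they are functionally independent exactly off the hyperplane `Δ₁ = 0`; and
near every point of the region off that hyperplane every analytic invariant is, locally and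
uniquely, an analytic function of them. -/
theorem mainTheorem4 :
    (∀ i : Fin 3, IsInvariantOn Set.univ fun a => fundInvariants a i) ∧
    (∀ x ∈ regularRegion,
      ((LinearIndependent ℝ fun i : Fin 3 => fderiv ℝ (fun a => fundInvariants a i) x) ↔
        x 5 ≠ 0)) ∧
    ∀ (U : Set (Fin 6 → ℝ)) (I : (Fin 6 → ℝ) → ℝ), IsOpen U → AnalyticOnNhd ℝ I U →
      IsInvariantOn U I → ∀ x ∈ U ∩ regularRegion, x 5 ≠ 0 →
        ∃ F : (Fin 3 → ℝ) → ℝ, AnalyticAt ℝ F (fundInvariants x) ∧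
          (∀ᶠ a in 𝓝 x, I a = F (fundInvariants a)) ∧
          ∀ G : (Fin 3 → ℝ) → ℝ, (∀ᶠ a in 𝓝 x, I a = G (fundInvariants a)) →
            G =ᶠ[𝓝 (fundInvariants x)] F := by
  refine ⟨isInvariantOn_fundInvariants, fun x hx =>
    linearIndependent_fderiv_fundInvariants_iff hx, ?_⟩
  rintro U I hU hI hinv x ⟨hxU, hxR⟩ h5
  obtain ⟨ε, hε, hP⟩ := exists_nullCoordinate_ne_zero hxR h5
  have hself := invariantSection_fundInvariants_self hε hP h5
  have hs : AnalyticAt ℝ (invariantSection ε x) (fundInvariants x) :=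
    analyticAt_invariantSection h5
  have hlim : Tendsto (invariantSection ε x) (𝓝 (fundInvariants x)) (𝓝 x) := by
    simpa only [hself] using hs.continuousAt.tendsto
  have hΔ := continuous_fundInvariants.tendsto x
  refine ⟨I ∘ invariantSection ε x, ?_, ?_, fun G hG => ?_⟩
  · exact AnalyticAt.comp (by rw [hself]; exact hI x hxU) hs
  -- A level set of `Δ` can contain several orbits; near `x` the sign of `P_ε` selects the right
  -- one.
  · have hsgn : ∀ᶠ a in 𝓝 x, 0 < nullCoordinate ε x / nullCoordinate ε a := by
      have hdiv : Tendsto (fun a => nullCoordinate ε x / nullCoordinate ε a) (𝓝 x)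
          (𝓝 (nullCoordinate ε x / nullCoordinate ε x)) :=
        tendsto_const_nhds.div ((continuous_nullCoordinate ε).tendsto x) hP
      rw [div_self hP] at hdiv
      exact hdiv.eventually_const_lt one_pos
    -- Invariance only compares points of `U`, so both `a` and `σ (Δ a)` must lie there.
    filter_upwards [hU.mem_nhds hxU, hΔ.eventually (hlim.eventually (hU.mem_nhds hxU)), hsgn,
      (continuous_apply (5 : Fin 6)).continuousAt.eventually_ne h5] with a haU hsU ha ha5
    have ha0 : fundInvariants a 0 ≠ 0 := ha5
    obtain ⟨g, hg⟩ := exists_transform_eq hε ha5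
      (fundInvariants_invariantSection hε hP ha0).symm
      (by rwa [nullCoordinate_invariantSection_self hε ha0])
    have := hinv g a haU (by rw [hg]; exact hsU)
    rw [hg] at this
    exact this.symm
  · have h0 : ∀ᶠ d in 𝓝 (fundInvariants x), d 0 ≠ 0 :=
      (continuous_apply (0 : Fin 3)).continuousAt.eventually_ne h5
    -- Evaluating `I = G ∘ Δ` at `σ d` gives `G d = I (σ d)`.
    filter_upwards [hlim.eventually hG, h0] with d hd hd0
    rw [Function.comp_apply, hd, fundInvariants_invariantSection hε hP hd0]
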